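/- Fix a field $\mathbf k$ and write $\otimes=\otimes_{\mathbf k}$. All graded algebras are $\mathbb Z$-graded $\mathbf k$-algebras $A=\bigoplus_{i\ge 0}A_i$ such that $A_0$ is isomorphic as an algebra to a finite product of copies of $\mathbf k$, $\dim_{\mathbf k}A_1<\infty$, and $A$ is generated as an algebra by $A_0\oplus A_1$; modules are right modules, graded by $\mathbb Z$. For a collection $\mathcal S=(\mathcal S_i)_{i\ge 0}$ of subsets $\mathcal S_i\subseteq\mathbb Z$, a graded $A$-module $X$ is called $\mathcal S$-determined if it has a graded projective resolution $P_\bullet$ such that, for every $i\ge 0$, the $A$-module $P_i$ is generated by homogeneous elements of degrees belonging to $\mathcal S_i$. For two such collections put $$(\mathcal S\otimes\mathcal R)_i=\bigcup_{j+l=i,\ j,l\ge 0}\{n+m\mid n\in\mathcal S_j,\ m\in\mathcal R_l\}.$$ For $s\ge 2$ let $\chi_s(i)=\frac{is}{2}$ if $i$ is even and $\chi_s(i)=\frac{(i-1)s}{2}+1$ if $i$ is odd. The algebra $A$ is called $2$-$s$-determined if the graded right $A$-module $A_0=A/A_{>0}$ is $\mathcal S$-determined for $\mathcal S_i=\{j\in\mathbb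 Z\mid j\le\chi_s(i)\}$, and Koszul if $A_0$ is $\mathcal S$-determined for $\mathcal S_i=\{i\}$. Tensor products carry the total grading $(V\otimes W)_n=\bigoplus_{i+j=n}V_i\otimes W_j$. Let $A$ and $B$ be graded algebras as above. (1) If $X$ is an $\mathcal S$-determined graded $A$-module and $Y$ is an $\mathcal R$-determined graded $B$-module, then $X\otimes Y$, with the action $(x\otimes y)(a\otimes b)=xa\otimes yb$, is an $(\mathcal S\otimes\mathcal R)$-determined graded $A\otimes B$-module. (2) For every integer $s\ge 2$: if $A$ and $B$ are $2$-$s$-determined, then so is $A\otimes B$. (3) If $A$ and $B$ are Koszul, then so is $A\otimes B$. In (2) and (3) the conclusion includes that $A\otimes B$ is again a graded algebra of the above kind. -/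

import Mathlib

open scoped TensorProduct
open MulOpposite

universe v u

namespace GradedDet

section Basic

variable {k : Type v} [Field k] {A : Type u} [Ring A] [Algebra k A]

/-- `𝒜` makes `A` into a graded algebra of the class considered throughout: `A = ⨁ 𝒜 i` is a
`ℤ`-graded `k`-algebra concentrated in non-negative degrees, `𝒜 0` is isomorphic as an algebra to a
finite product of copies of `k`, `𝒜 1` is finite dimensional and `A` is generated by
`𝒜 0 ⊕ 𝒜 1`. (Equivalently, `A ≅ kQ/I` with `Q` a finite quiver and `I` a homogeneous ideal generated
in degrees at least two.) -/
structure IsQuiverGraded (𝒜 : ℤ → Submodule k A) : Prop extends SetLike.GradedMonoid 𝒜 where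
  isInternal : DirectSum.IsInternal 𝒜
  nonneg : ∀ i : ℤ, i < 0 → 𝒜 i = ⊥
  degree_zero : ∃ n : ℕ, Nonempty (𝒜 0 ≃ₐ[k] (Fin n → k))
  finite_degree_one : Module.Finite k (𝒜 1)
  generated : Algebra.adjoin k ((𝒜 0 : Set A) ∪ (𝒜 1 : Set A)) = ⊤

/-- `𝒳` makes the right `A`-module `X` (a module over `Aᵐᵒᵖ`) into a `ℤ`-graded right module over
`A` graded by `𝒜`: `X = ⨁ 𝒳 j` and `𝒳 j * 𝒜 i ⊆ 𝒳 (j + i)`. -/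
structure IsGradedModule (𝒜 : ℤ → Submodule k A) {X : Type u} [AddCommGroup X] [Module k X]
    [Module Aᵐᵒᵖ X] [IsScalarTower k Aᵐᵒᵖ X] (𝒳 : ℤ → Submodule k X) : Prop where
  isInternal : DirectSum.IsInternal 𝒳
  smul_mem : ∀ (j i : ℤ) (x : X) (a : A), x ∈ 𝒳 j → a ∈ 𝒜 i → op a • x ∈ 𝒳 (j + i)

/-- A graded projective resolution `⋯ → P 1 → P 0 → X → 0` of the graded right module `X`:
an exact sequence of graded right modules and homogeneous maps of degree zero, with every `P i`
projective. -/
structure GradedProjectiveResolution (𝒜 : ℤ → Submodule k A) {X : Type u} [AddCommGroup X]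
    [Module k X] [Module Aᵐᵒᵖ X] [IsScalarTower k Aᵐᵒᵖ X] (𝒳 : ℤ → Submodule k X) where
  P : ℕ → Type u
  [addCommGroup : ∀ i, AddCommGroup (P i)]
  [moduleBase : ∀ i, Module k (P i)]
  [module : ∀ i, Module Aᵐᵒᵖ (P i)]
  [isScalarTower : ∀ i, IsScalarTower k Aᵐᵒᵖ (P i)]
  /-- the degree `n` component of `P i` is `deg i n` -/
  deg : ∀ i, ℤ → Submodule k (P i)
  graded : ∀ i, IsGradedModule 𝒜 (deg i)
  projective : ∀ i, Module.Projective Aᵐᵒᵖ (P i)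
  d : ∀ i, P (i + 1) →ₗ[Aᵐᵒᵖ] P i
  d_mem : ∀ i n x, x ∈ deg (i + 1) n → d i x ∈ deg i n
  ε : P 0 →ₗ[Aᵐᵒᵖ] X
  ε_mem : ∀ n x, x ∈ deg 0 n → ε x ∈ 𝒳 n
  ε_surjective : Function.Surjective ε
  exact_zero : Function.Exact (d 0) ε
  exact_succ : ∀ i, Function.Exact (d (i + 1)) (d i)

attribute [instance] GradedProjectiveResolution.addCommGroup
  GradedProjectiveResolution.moduleBase GradedProjectiveResolution.module
  GradedProjectiveResolution.isScalarTower

/-- The graded right `A`-module `X` is `𝒮`-determined: it has a graded projective resolution `P`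
such that `P i` is generated by its homogeneous elements of degrees in `𝒮 i`, for all `i`. -/
def IsDetermined (𝒜 : ℤ → Submodule k A) {X : Type u} [AddCommGroup X] [Module k X]
    [Module Aᵐᵒᵖ X] [IsScalarTower k Aᵐᵒᵖ X] (𝒳 : ℤ → Submodule k X) (𝒮 : ℕ → Set ℤ) : Prop :=
  IsGradedModule 𝒜 𝒳 ∧
    ∃ R : GradedProjectiveResolution 𝒜 𝒳, ∀ i : ℕ,
      Submodule.span Aᵐᵒᵖ (⋃ j ∈ 𝒮 i, (R.deg i j : Set (R.P i))) = ⊤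

/-- The right ideal `A_{>0}` of `A` generated by the homogeneous elements of positive degree. -/
def positivePart (𝒜 : ℤ → Submodule k A) : Submodule Aᵐᵒᵖ A :=
  Submodule.span Aᵐᵒᵖ (⋃ i > (0 : ℤ), (𝒜 i : Set A))

/-- The right `A`-module `A_0`, as the graded quotient `A / A_{>0}` of `A`. -/
abbrev DegreeZero (𝒜 : ℤ → Submodule k A) : Type u := A ⧸ positivePart 𝒜

/-- The grading of `A_0 = A / A_{>0}` induced by that of `A`: the degree `n` component is the image
of `𝒜 n` (it vanishes for `n ≠ 0` when `A` is non-negatively graded). -/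
def degreeZeroGrading (𝒜 : ℤ → Submodule k A) : ℤ → Submodule k (DegreeZero 𝒜) :=
  fun n => (𝒜 n).map ((positivePart 𝒜).mkQ.restrictScalars k)

/-- `χ_s(i)` is `i s / 2` for even `i` and `(i - 1) s / 2 + 1` for odd `i` (both divisions are
exact). -/
def chi (s i : ℕ) : ℤ :=
  if Even i then (i : ℤ) * s / 2 else ((i : ℤ) - 1) * s / 2 + 1

/-- The graded algebra `A` is `2`-`s`-determined: `A_0` has a graded projective resolution whose
`i`-th term is generated in degrees at most `χ_s(i)`. -/
def IsTwoSDetermined (s : ℕ) (𝒜 : ℤ → Submodule k A) : Prop :=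
  IsQuiverGraded 𝒜 ∧ IsDetermined 𝒜 (degreeZeroGrading 𝒜) (fun i => {j | j ≤ chi s i})

/-- The graded algebra `A` is Koszul: `A_0` has a graded projective resolution whose `i`-th term is
generated in degree `i`. -/
def IsKoszul (𝒜 : ℤ → Submodule k A) : Prop :=
  IsQuiverGraded 𝒜 ∧ IsDetermined 𝒜 (degreeZeroGrading 𝒜) (fun i => {(i : ℤ)})

/-- The collection `𝒮 ⊗ ℛ`, with `(𝒮 ⊗ ℛ)_i = ⋃_{j + l = i} (𝒮_j + ℛ_l)`. -/
def tensorDegrees (𝒮 ℛ : ℕ → Set ℤ) : ℕ → Set ℤ :=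
  fun i => {p | ∃ j l : ℕ, j + l = i ∧ ∃ n ∈ 𝒮 j, ∃ m ∈ ℛ l, n + m = p}

end Basic

section Tensor

variable {k : Type v} [Field k]

/-- The total grading of `V ⊗ W`: its degree `n` component is the sum of the subspaces
`𝒱 i ⊗ 𝒲 j` with `i + j = n`. -/
def tensorGrading {V W : Type u} [AddCommGroup V] [Module k V] [AddCommGroup W] [Module k W]
    (𝒱 : ℤ → Submodule k V) (𝒲 : ℤ → Submodule k W) : ℤ → Submodule k (V ⊗[k] W) :=
  fun n => Submodule.span k
    {t | ∃ i j : ℤ, i + j = n ∧ ∃ x ∈ 𝒱 i, ∃ y ∈ 𝒲 j, t = x ⊗ₜ[k] y}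

variable (k) (A B X Y : Type u) [Ring A] [Algebra k A] [Ring B] [Algebra k B]
  [AddCommGroup X] [Module k X] [Module Aᵐᵒᵖ X] [IsScalarTower k Aᵐᵒᵖ X]
  [AddCommGroup Y] [Module k Y] [Module Bᵐᵒᵖ Y] [IsScalarTower k Bᵐᵒᵖ Y]

/-- The right action of `A ⊗ B` on `X ⊗ Y` as an algebra homomorphism to the endomorphisms. -/
noncomputable def tensorAction : (A ⊗[k] B)ᵐᵒᵖ →ₐ[k] Module.End k (X ⊗[k] Y) :=
  (Module.endTensorEndAlgHom (R := k) (A := k) (M := X) (N := Y)).comp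
    ((Algebra.TensorProduct.map (Algebra.lsmul k k X : Aᵐᵒᵖ →ₐ[k] Module.End k X)
      (Algebra.lsmul k k Y : Bᵐᵒᵖ →ₐ[k] Module.End k Y)).comp
      (Algebra.TensorProduct.opAlgEquiv k k A B).symm.toAlgHom)

/-- The right `A ⊗ B`-module structure on `X ⊗ Y`, given by `(x ⊗ y)(a ⊗ b) = xa ⊗ yb`. -/
@[reducible]
noncomputable def tensorRightModule : Module (A ⊗[k] B)ᵐᵒᵖ (X ⊗[k] Y) :=
  Module.compHom (X ⊗[k] Y) (tensorAction k A B X Y).toRingHom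

theorem tensorRightModule_tmul (a : A) (b : B) (x : X) (y : Y) :
    letI := tensorRightModule k A B X Y
    op (a ⊗ₜ[k] b) • (x ⊗ₜ[k] y) = (op a • x) ⊗ₜ[k] (op b • y) := by
  change tensorAction k A B X Y (op (a ⊗ₜ[k] b)) (x ⊗ₜ[k] y) = _
  simp only [tensorAction, AlgHom.comp_apply]
  rfl

theorem tensorRightModule_isScalarTower :
    letI := tensorRightModule k A B X Y
    IsScalarTower k (A ⊗[k] B)ᵐᵒᵖ (X ⊗[k] Y) := by
  let := tensorRightModule k A B X Y
  refine ⟨fun c t z => ?_⟩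
  change tensorAction k A B X Y (c • t) z = c • tensorAction k A B X Y t z
  rw [map_smul, LinearMap.smul_apply]

end Tensor

end GradedDet

/-! Let `P → X` and `Q → Y` be the given resolutions. The candidate resolution of `X ⊗ Y` is the
total complex of `P ⊗ Q`. Each `P i ⊗ Q j` is projective over `A ⊗ B` (`projective_tensor`) and is
generated in degrees from `𝒮 i + ℛ j` (`span_tensor`), so only exactness is at stake. Exactness
concerns the underlying vector spaces. Over a field every augmented resolution has a linear
contraction (`exists_homotopy`). If `r`, `σ` contract `P → X` and `s`, `τ` contract `Q → Y`, then `r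
⊗ 1`, together with `σε ⊗ s` on the column `i = 0`, contracts the total complex onto `X ⊗ Y`. This
gives (1). For (2) and (3), `A_0 ⊗ B_0` is identified with the degree zero quotient of `A ⊗ B` as a
graded module (`ker_degreeZeroProj`), so (1) applies to it. What remains is arithmetic of degrees:
`{j} + {l} = {j + l}` in the Koszul case, and superadditivity of `χ_s` (`chi_add_le`) in the other.
The class of algebras is stable because non-negativity leaves only `A_0 ⊗ B_0` in degree 0 and `A_0
⊗ B_1 + A_1 ⊗ B_0` in degree 1. -/

namespace GradedDet

/-! ### Projectivity and generators of tensor products over `A ⊗ B` -/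

section TensorModules

variable {k : Type v} [Field k] {A B : Type u} [Ring A] [Algebra k A] [Ring B] [Algebra k B]

attribute [local instance 50] tensorRightModule tensorRightModule_isScalarTower

section Linear

variable {X Y X' Y' M : Type u}
  [AddCommGroup X] [Module k X] [Module Aᵐᵒᵖ X] [IsScalarTower k Aᵐᵒᵖ X]
  [AddCommGroup Y] [Module k Y] [Module Bᵐᵒᵖ Y] [IsScalarTower k Bᵐᵒᵖ Y]
  [AddCommGroup X'] [Module k X'] [Module Aᵐᵒᵖ X'] [IsScalarTower k Aᵐᵒᵖ X']
  [AddCommGroup Y'] [Module k Y'] [Module Bᵐᵒᵖ Y'] [IsScalarTower k Bᵐᵒᵖ Y']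
  [AddCommGroup M] [Module k M] [Module (A ⊗[k] B)ᵐᵒᵖ M]

theorem op_tmul_smul_tmul (a : A) (b : B) (x : X) (y : Y) :
    op (a ⊗ₜ[k] b) • (x ⊗ₜ[k] y) = (op a • x) ⊗ₜ[k] (op b • y) :=
  tensorRightModule_tmul k A B X Y a b x y

/-- A `k`-linear map out of `X ⊗ Y` that is compatible with the action of pure tensors on pure
tensors is linear over `A ⊗ B`. -/
def tensorLinear (f : X ⊗[k] Y →ₗ[k] M)
    (h : ∀ (a : A) (b : B) (x : X) (y : Y),
      f ((op a • x) ⊗ₜ[k] (op b • y)) = op (a ⊗ₜ[k] b) • f (x ⊗ₜ[k] y)) :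
    X ⊗[k] Y →ₗ[(A ⊗[k] B)ᵐᵒᵖ] M where
  toFun := f
  map_add' := f.map_add
  map_smul' := by
    intro c z
    obtain ⟨c, rfl⟩ := op_surjective c
    simp only [RingHom.id_apply]
    induction z with
    | zero => simp
    | add z w hz hw => simp only [smul_add, map_add, hz, hw]
    | tmul x y =>
      induction c with
      | zero => simp
      | add c d hc hd => simp only [op_add, add_smul, map_add, hc, hd]
      | tmul a b => rw [op_tmul_smul_tmul, h]

/-- The tensor product of two module homomorphisms, as a homomorphism over `A ⊗ B`. -/
noncomputable def tensorMap (f : X →ₗ[Aᵐᵒᵖ] X') (g : Y →ₗ[Bᵐᵒᵖ] Y') :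
    X ⊗[k] Y →ₗ[(A ⊗[k] B)ᵐᵒᵖ] X' ⊗[k] Y' :=
  tensorLinear (TensorProduct.map (f.restrictScalars k) (g.restrictScalars k)) fun a b x y => by
    simp [op_tmul_smul_tmul]

@[simp]
theorem tensorMap_tmul (f : X →ₗ[Aᵐᵒᵖ] X') (g : Y →ₗ[Bᵐᵒᵖ] Y') (x : X) (y : Y) :
    tensorMap (k := k) f g (x ⊗ₜ[k] y) = f x ⊗ₜ[k] g y := rfl

/-- The tensor product of two projective modules is projective over the tensor product of the
algebras. -/
theorem projective_tensor [hX : Module.Projective Aᵐᵒᵖ X] [hY : Module.Projective Bᵐᵒᵖ Y] :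
    Module.Projective (A ⊗[k] B)ᵐᵒᵖ (X ⊗[k] Y) := by
  obtain ⟨s, hs⟩ := hX
  obtain ⟨t, ht⟩ := hY
  -- `s` and `t` split the canonical maps from the free modules on the sets `X` and `Y`. Through
  -- `φ`, the tensor product of these free modules maps to the free module on `X × Y`, and `φ ∘ (s ⊗
  -- t)` splits the map to `X ⊗ Y`.
  let φ : ((X →₀ Aᵐᵒᵖ) ⊗[k] (Y →₀ Bᵐᵒᵖ)) →ₗ[k] (X × Y →₀ (A ⊗[k] B)ᵐᵒᵖ) :=
    (Finsupp.mapRange.linearMap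
      (Algebra.TensorProduct.opAlgEquiv k k A B).toLinearMap).comp
      (finsuppTensorFinsupp k k Aᵐᵒᵖ Bᵐᵒᵖ X Y).toLinearMap
  have hφ : ∀ (x : X) (y : Y) (a : A) (b : B),
      φ (Finsupp.single x (op a) ⊗ₜ Finsupp.single y (op b)) =
        Finsupp.single (x, y) (op (a ⊗ₜ[k] b)) := by
    intro x y a b
    simp [φ, finsuppTensorFinsupp_single]
  have hφs : ∀ (a : A) (b : B) (f : X →₀ Aᵐᵒᵖ) (g : Y →₀ Bᵐᵒᵖ),
      φ ((op a • f) ⊗ₜ (op b • g)) = op (a ⊗ₜ[k] b) • φ (f ⊗ₜ g) := by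
    intro a b f g
    induction f using Finsupp.induction_linear with
    | zero => simp
    | add f f' hf hf' => simp only [smul_add, TensorProduct.add_tmul, map_add, hf, hf']
    | single x c =>
      induction g using Finsupp.induction_linear with
      | zero => simp
      | add f f' hf hf' => simp only [smul_add, TensorProduct.tmul_add, map_add, hf, hf']
      | single y d =>
        obtain ⟨c, rfl⟩ := op_surjective c
        obtain ⟨d, rfl⟩ := op_surjective d
        rw [hφ, Finsupp.smul_single, Finsupp.smul_single, smul_eq_mul, smul_eq_mul, ← op_mul,
          ← op_mul, hφ, Finsupp.smul_single, smul_eq_mul, ← op_mul,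
          Algebra.TensorProduct.tmul_mul_tmul]
  let Φ : ((X →₀ Aᵐᵒᵖ) ⊗[k] (Y →₀ Bᵐᵒᵖ)) →ₗ[(A ⊗[k] B)ᵐᵒᵖ] (X × Y →₀ (A ⊗[k] B)ᵐᵒᵖ) :=
    tensorLinear φ hφs
  have key : ∀ (f : X →₀ Aᵐᵒᵖ) (g : Y →₀ Bᵐᵒᵖ),
      Finsupp.linearCombination (A ⊗[k] B)ᵐᵒᵖ (fun p : X × Y => p.1 ⊗ₜ[k] p.2) (φ (f ⊗ₜ g)) =
        Finsupp.linearCombination Aᵐᵒᵖ id f ⊗ₜ[k] Finsupp.linearCombination Bᵐᵒᵖ id g := by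
    intro f g
    induction f using Finsupp.induction_linear with
    | zero => simp
    | add f f' hf hf' => simp only [TensorProduct.add_tmul, map_add, hf, hf']
    | single x c =>
      induction g using Finsupp.induction_linear with
      | zero => simp
      | add f f' hf hf' => simp only [TensorProduct.tmul_add, map_add, hf, hf']
      | single y d =>
        obtain ⟨c, rfl⟩ := op_surjective c
        obtain ⟨d, rfl⟩ := op_surjective d
        rw [hφ]
        simp [op_tmul_smul_tmul]
  refine Module.Projective.of_split (Φ ∘ₗ tensorMap s t)
    (Finsupp.linearCombination (A ⊗[k] B)ᵐᵒᵖ (fun p : X × Y => p.1 ⊗ₜ[k] p.2)) ?_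
  ext z
  induction z with
  | zero => simp
  | add z w hz hw => rw [map_add, hz, hw, map_add]
  | tmul x y =>
    change Finsupp.linearCombination _ _ (φ (s x ⊗ₜ t y)) = x ⊗ₜ y
    rw [key, hs x, ht y]

/-- The elements `a ⊗ 1` and `1 ⊗ b` act on one factor at a time, so each factor can be reduced to
its generators separately. -/
theorem span_tensor {U : Set X} {V : Set Y} {W : Set (X ⊗[k] Y)}
    (hU : Submodule.span Aᵐᵒᵖ U = ⊤) (hV : Submodule.span Bᵐᵒᵖ V = ⊤)
    (hW : ∀ x ∈ U, ∀ y ∈ V, x ⊗ₜ[k] y ∈ W) : Submodule.span (A ⊗[k] B)ᵐᵒᵖ W = ⊤ := by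
  have key : ∀ (x : X) (y : Y), x ⊗ₜ[k] y ∈ Submodule.span (A ⊗[k] B)ᵐᵒᵖ W := by
    intro x y
    have hx : x ∈ Submodule.span Aᵐᵒᵖ U := hU ▸ Submodule.mem_top
    have hy : y ∈ Submodule.span Bᵐᵒᵖ V := hV ▸ Submodule.mem_top
    induction hx using Submodule.span_induction with
    | zero => simp
    | add x x' _ _ h h' => rw [TensorProduct.add_tmul]; exact add_mem h h'
    | smul a x _ h =>
      have := Submodule.smul_mem _ (op (a.unop ⊗ₜ[k] (1 : B))) h
      rwa [op_tmul_smul_tmul, op_unop, op_one, one_smul] at this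
    | mem x hx =>
      induction hy using Submodule.span_induction with
      | zero => simp
      | add x x' _ _ h h' => rw [TensorProduct.tmul_add]; exact add_mem h h'
      | smul a x _ h =>
        have := Submodule.smul_mem _ (op ((1 : A) ⊗ₜ[k] a.unop)) h
        rwa [op_tmul_smul_tmul, op_unop, op_one, one_smul] at this
      | mem y hy => exact Submodule.subset_span (hW x hx y hy)
  refine Submodule.eq_top_iff'.2 fun z => ?_
  induction z with
  | zero => simp
  | add z w hz hw => exact add_mem hz hw
  | tmul x y => exact key x y

end Linear

end TensorModules

/-! ### Gradings on tensor products and direct sums of vector spaces -/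

section Gradings

variable {k : Type v} [Field k] {V W V' W' : Type u} [AddCommGroup V] [Module k V] [AddCommGroup W]
  [Module k W] [AddCommGroup V'] [Module k V'] [AddCommGroup W'] [Module k W']

theorem tmul_mem_tensorGrading {𝒱 : ℤ → Submodule k V} {𝒲 : ℤ → Submodule k W} {i j n : ℤ}
    (h : i + j = n) {x : V} {y : W} (hx : x ∈ 𝒱 i) (hy : y ∈ 𝒲 j) :
    x ⊗ₜ[k] y ∈ tensorGrading 𝒱 𝒲 n :=
  Submodule.subset_span ⟨i, j, h, x, hx, y, hy, rfl⟩

theorem tensorGrading_le {𝒱 : ℤ → Submodule k V} {𝒲 : ℤ → Submodule k W} {n : ℤ}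
    {N : Submodule k (V ⊗[k] W)}
    (h : ∀ i j : ℤ, i + j = n → ∀ x ∈ 𝒱 i, ∀ y ∈ 𝒲 j, x ⊗ₜ[k] y ∈ N) :
    tensorGrading 𝒱 𝒲 n ≤ N := by
  refine Submodule.span_le.2 ?_
  rintro _ ⟨i, j, hij, x, hx, y, hy, rfl⟩
  exact h i j hij x hx y hy

/-- Tensor products commute with direct sums. The inverse of the summation map is built explicitly:
`β` places a tensor of homogeneous elements in degree `i + j`, and `γ` extends this bilinearly along
the two decompositions. -/
theorem isInternal_tensorGrading {𝒱 : ℤ → Submodule k V} {𝒲 : ℤ → Submodule k W}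
    (h𝒱 : DirectSum.IsInternal 𝒱) (h𝒲 : DirectSum.IsInternal 𝒲) :
    DirectSum.IsInternal (tensorGrading 𝒱 𝒲) := by
  classical
  let := h𝒱.chooseDecomposition
  let := h𝒲.chooseDecomposition
  let β : ∀ i j : ℤ, 𝒱 i →ₗ[k] 𝒲 j →ₗ[k] DirectSum ℤ fun n => tensorGrading 𝒱 𝒲 n :=
    fun i j => LinearMap.mk₂ k
      (fun x y => DirectSum.lof k ℤ (fun n => tensorGrading 𝒱 𝒲 n) (i + j)
        ⟨x.1 ⊗ₜ[k] y.1, tmul_mem_tensorGrading rfl x.2 y.2⟩)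
      (fun x x' y => by
        rw [← map_add]; congr 1; ext; simp [TensorProduct.add_tmul])
      (fun c x y => by rw [← map_smul]; rfl)
      (fun x y y' => by
        rw [← map_add]; congr 1; ext; simp [TensorProduct.tmul_add])
      (fun c x y => by rw [← map_smul]; congr 1; ext; simp)
  let γ : V →ₗ[k] W →ₗ[k] DirectSum ℤ fun n => tensorGrading 𝒱 𝒲 n :=
    ((DirectSum.toModule k ℤ _ fun i => LinearMap.flip
      ((DirectSum.toModule k ℤ _ fun j => (β i j).flip) ∘ₗ
        (DirectSum.decomposeLinearEquiv 𝒲).toLinearMap))) ∘ₗ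
        (DirectSum.decomposeLinearEquiv 𝒱).toLinearMap
  have hγ : ∀ (i j : ℤ) (x : 𝒱 i) (y : 𝒲 j), γ x.1 y.1 = β i j x y := by
    intro i j x y
    simp only [γ, LinearMap.comp_apply, LinearEquiv.coe_coe,
      DirectSum.decomposeLinearEquiv_apply, DirectSum.decompose_coe]
    erw [DirectSum.toModule_lof]
    simp only [LinearMap.flip_apply, LinearMap.comp_apply, LinearEquiv.coe_coe,
      DirectSum.decomposeLinearEquiv_apply, DirectSum.decompose_coe]
    erw [DirectSum.toModule_lof]
    rfl
  refine (DirectSum.Decomposition.ofLinearMap _ (TensorProduct.lift γ) ?_ ?_).isInternal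
  · ext x y
    simp only [TensorProduct.AlgebraTensorModule.curry_apply, LinearMap.restrictScalars_self,
      TensorProduct.curry_apply, LinearMap.comp_apply, TensorProduct.lift.tmul, LinearMap.id_apply]
    induction x using DirectSum.Decomposition.inductionOn 𝒱 with
    | zero => simp
    | add x x' h h' => simp only [map_add, LinearMap.add_apply, TensorProduct.add_tmul, h, h']
    | @homogeneous i x =>
      induction y using DirectSum.Decomposition.inductionOn 𝒲 with
      | zero => simp
      | add x x' h h' => simp only [map_add, TensorProduct.tmul_add, h, h']
      | @homogeneous j y => rw [hγ]; simp [β]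
  · refine DirectSum.linearMap_ext _ fun n => LinearMap.ext fun ⟨z, hz⟩ => ?_
    simp only [LinearMap.comp_apply, LinearMap.id_apply, DirectSum.coeLinearMap_lof]
    induction hz using Submodule.span_induction with
    | zero => rw [map_zero]; exact (map_zero _).symm
    | add z w hz hw h h' =>
      rw [map_add, h, h', ← map_add]; rfl
    | smul c z hz h => rw [map_smul, h, ← map_smul]; rfl
    | mem z hz =>
      obtain ⟨i, j, rfl, x, hx, y, hy, rfl⟩ := hz
      exact hγ i j ⟨x, hx⟩ ⟨y, hy⟩

/-- The grading of a direct sum of graded vector spaces. -/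
def sumGrading {ι : Type} {M : ι → Type u} [∀ p, AddCommGroup (M p)] [∀ p, Module k (M p)]
    (𝒢 : ∀ p, ℤ → Submodule k (M p)) (n : ℤ) : Submodule k (DirectSum ι M) where
  carrier := {x | ∀ p, x p ∈ 𝒢 p n}
  zero_mem' := fun p => (𝒢 p n).zero_mem
  add_mem' := fun hx hy p => add_mem (hx p) (hy p)
  smul_mem' := fun c _ hx p => (𝒢 p n).smul_mem c (hx p)

theorem lof_mem_sumGrading {ι : Type} [DecidableEq ι] {M : ι → Type u} [∀ p, AddCommGroup (M p)]
    [∀ p, Module k (M p)] {𝒢 : ∀ p, ℤ → Submodule k (M p)} {n : ℤ} {p : ι} {x : M p}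
    (hx : x ∈ 𝒢 p n) : DirectSum.lof k ι M p x ∈ sumGrading 𝒢 n := by
  intro q
  by_cases h : p = q
  · subst h
    rwa [DirectSum.lof_apply]
  · rw [DirectSum.lof_eq_of, DirectSum.of_eq_of_ne _ _ _ (Ne.symm h)]
    exact zero_mem _

theorem sumGrading_induction {ι : Type} [DecidableEq ι] {M : ι → Type u}
    [∀ p, AddCommGroup (M p)] [∀ p, Module k (M p)] {𝒢 : ∀ p, ℤ → Submodule k (M p)} {n : ℤ}
    {N : Submodule k (DirectSum ι M)}
    (h : ∀ p, ∀ x ∈ 𝒢 p n, DirectSum.lof k ι M p x ∈ N) : sumGrading 𝒢 n ≤ N := by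
  classical
  intro x hx
  rw [← DirectSum.sum_support_of x]
  exact sum_mem fun p _ => h p _ (hx p)

theorem isInternal_sumGrading {ι : Type} [DecidableEq ι] {M : ι → Type u}
    [∀ p, AddCommGroup (M p)] [∀ p, Module k (M p)] {𝒢 : ∀ p, ℤ → Submodule k (M p)}
    (h : ∀ p, DirectSum.IsInternal (𝒢 p)) : DirectSum.IsInternal (sumGrading 𝒢) := by
  classical
  let := fun p => (h p).chooseDecomposition
  let δ : DirectSum ι M →ₗ[k] DirectSum ℤ fun n => sumGrading 𝒢 n :=
    DirectSum.toModule k ι _ fun p =>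
      (DirectSum.toModule k ℤ _ fun n =>
        (DirectSum.lof k ℤ (fun n => sumGrading 𝒢 n) n) ∘ₗ
          ((DirectSum.lof k ι M p ∘ₗ (𝒢 p n).subtype).codRestrict _
            fun y => lof_mem_sumGrading y.2)) ∘ₗ
        (DirectSum.decomposeLinearEquiv (𝒢 p)).toLinearMap
  have hδ : ∀ p n (x : 𝒢 p n), δ (DirectSum.lof k ι M p x.1) =
      DirectSum.lof k ℤ (fun n => sumGrading 𝒢 n) n
        ⟨DirectSum.lof k ι M p x.1, lof_mem_sumGrading x.2⟩ := by
    intro p n x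
    simp only [δ, DirectSum.toModule_lof, LinearMap.comp_apply, LinearEquiv.coe_coe,
      DirectSum.decomposeLinearEquiv_apply, DirectSum.decompose_coe]
    erw [DirectSum.toModule_lof]
    rfl
  refine (DirectSum.Decomposition.ofLinearMap _ δ ?_ ?_).isInternal
  · refine DirectSum.linearMap_ext _ fun p => LinearMap.ext fun x => ?_
    simp only [LinearMap.comp_apply, LinearMap.id_apply]
    induction x using DirectSum.Decomposition.inductionOn (𝒢 p) with
    | zero => simp
    | add x x' h h' => simp only [map_add, h, h']
    | @homogeneous n x => rw [hδ, DirectSum.coeLinearMap_lof]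
  · refine DirectSum.linearMap_ext _ fun n => LinearMap.ext fun ⟨z, hz⟩ => ?_
    simp only [LinearMap.comp_apply, LinearMap.id_apply, DirectSum.coeLinearMap_lof]
    -- The identity to be proved is linear in `z`, so its solutions form a submodule of `sumGrading
    -- 𝒢 n`. Pushing that submodule into the direct sum lets it be tested on single summands.
    have hle : sumGrading 𝒢 n ≤ (LinearMap.eqLocus (δ ∘ₗ (sumGrading 𝒢 n).subtype)
        (DirectSum.lof k ℤ (fun n => sumGrading 𝒢 n) n)).map (sumGrading 𝒢 n).subtype :=
      sumGrading_induction fun p x hx => ⟨⟨_, lof_mem_sumGrading hx⟩, hδ p n ⟨x, hx⟩, rfl⟩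
    obtain ⟨w, hw, rfl⟩ := hle hz
    exact hw

end Gradings

end GradedDet

namespace GradedDet

/-! ### Graded modules: tensor products and direct sums -/

section GradedTensor

variable {k : Type v} [Field k] {A B : Type u} [Ring A] [Algebra k A] [Ring B] [Algebra k B]

attribute [local instance 50] tensorRightModule tensorRightModule_isScalarTower

variable {𝒜 : ℤ → Submodule k A} {ℬ : ℤ → Submodule k B} {X Y : Type u}
  [AddCommGroup X] [Module k X] [Module Aᵐᵒᵖ X] [IsScalarTower k Aᵐᵒᵖ X]
  [AddCommGroup Y] [Module k Y] [Module Bᵐᵒᵖ Y] [IsScalarTower k Bᵐᵒᵖ Y]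
  {𝒳 : ℤ → Submodule k X} {𝒴 : ℤ → Submodule k Y}

theorem isGradedModule_tensor (h𝒳 : IsGradedModule 𝒜 𝒳) (h𝒴 : IsGradedModule ℬ 𝒴) :
    IsGradedModule (tensorGrading 𝒜 ℬ) (tensorGrading 𝒳 𝒴) where
  isInternal := isInternal_tensorGrading h𝒳.isInternal h𝒴.isInternal
  smul_mem := by
    intro j i z c hz hc
    induction hc using Submodule.span_induction with
    | zero => simp
    | add c d _ _ h h' => rw [op_add, add_smul]; exact add_mem h h'
    | smul r c _ h => rw [op_smul, smul_assoc]; exact Submodule.smul_mem _ _ h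
    | mem c hc =>
      obtain ⟨m, n, rfl, a, ha, b, hb, rfl⟩ := hc
      induction hz using Submodule.span_induction with
      | zero => simp
      | add c d _ _ h h' => rw [smul_add]; exact add_mem h h'
      | smul r c _ h =>
        rw [smul_algebra_smul_comm]
        exact Submodule.smul_mem _ _ h
      | mem z hz =>
        obtain ⟨m', n', rfl, x, hx, y, hy, rfl⟩ := hz
        rw [op_tmul_smul_tmul]
        exact tmul_mem_tensorGrading (by ring) (h𝒳.smul_mem _ _ _ _ hx ha)
          (h𝒴.smul_mem _ _ _ _ hy hb)

theorem isGradedModule_sum {ι : Type} [DecidableEq ι] {M : ι → Type u} [∀ p, AddCommGroup (M p)]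
    [∀ p, Module k (M p)] [∀ p, Module Aᵐᵒᵖ (M p)] [∀ p, IsScalarTower k Aᵐᵒᵖ (M p)]
    {𝒢 : ∀ p, ℤ → Submodule k (M p)} (h : ∀ p, IsGradedModule 𝒜 (𝒢 p)) :
    IsGradedModule 𝒜 (sumGrading 𝒢) where
  isInternal := isInternal_sumGrading fun p => (h p).isInternal
  smul_mem := fun j i x a hx ha p => (h p).smul_mem j i (x p) a (hx p) ha

end GradedTensor

/-! ### Linear contractions of resolutions -/

section Homotopy

variable {k : Type v} [Field k] {A : Type u} [Ring A] [Algebra k A] {𝒜 : ℤ → Submodule k A}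
  {X : Type u} [AddCommGroup X] [Module k X] [Module Aᵐᵒᵖ X] [IsScalarTower k Aᵐᵒᵖ X]
  {𝒳 : ℤ → Submodule k X}

/-- Over a field an exact pair `U → V → W` has partial inverses. -/
theorem exists_section_of_exact {U V W : Type u} [AddCommGroup U] [Module k U] [AddCommGroup V]
    [Module k V] [AddCommGroup W] [Module k W] {f : U →ₗ[k] V} {g : V →ₗ[k] W}
    (h : Function.Exact f g) (s : W →ₗ[k] V) (hs : ∀ v, g (s (g v)) = g v) :
    ∃ t : V →ₗ[k] U, (∀ v, f (t v) + s (g v) = v) ∧ ∀ u, f (t (f u)) = f u := by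
  -- With `r` a linear section of `f` onto its range, take `t = r ∘ (1 - s ∘ g)`. This makes sense
  -- because `1 - s ∘ g` lands in `ker g = im f`.
  obtain ⟨r, hr⟩ := f.rangeRestrict.exists_rightInverse_of_surjective f.range_rangeRestrict
  have hmem : ∀ v, (LinearMap.id - s ∘ₗ g : V →ₗ[k] V) v ∈ LinearMap.range f := fun v =>
    (h _).1 (by simp [hs])
  have key : ∀ v, f ((r ∘ₗ (LinearMap.id - s ∘ₗ g).codRestrict _ hmem) v) + s (g v) = v := by
    intro v
    have := congrArg Subtype.val (LinearMap.congr_fun hr ⟨_, hmem v⟩)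
    simp only [LinearMap.comp_apply, LinearMap.id_apply, LinearMap.rangeRestrict,
      LinearMap.codRestrict_apply] at this
    rw [LinearMap.comp_apply]
    erw [this]
    simp
  refine ⟨_, key, fun u => ?_⟩
  have := key (f u)
  rwa [h.apply_apply_eq_zero, map_zero, add_zero] at this

/-- A `k`-linear contracting homotopy of an augmented resolution. -/
theorem GradedProjectiveResolution.exists_homotopy (R : GradedProjectiveResolution 𝒜 𝒳) :
    ∃ (σ : X →ₗ[k] R.P 0) (h : ∀ i, R.P i →ₗ[k] R.P (i + 1)),
      (∀ x, R.ε (σ x) = x) ∧ (∀ p, R.d 0 (h 0 p) + σ (R.ε p) = p) ∧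
      ∀ i p, R.d (i + 1) (h (i + 1) p) + h i (R.d i p) = p := by
  obtain ⟨σ, hσ⟩ := (R.ε.restrictScalars k).exists_rightInverse_of_surjective
    (LinearMap.range_eq_top.2 R.ε_surjective)
  have hσ' : ∀ x, R.ε (σ x) = x := fun x => LinearMap.congr_fun hσ x
  -- The identity `d t d = d` is what one step needs from the previous one and what it returns, so
  -- it drives the recursion.
  let Good : ∀ i, (R.P i →ₗ[k] R.P (i + 1)) → Prop := fun i t => ∀ u, R.d i (t (R.d i u)) = R.d i u
  have step : ∀ i (s : {s // Good i s}), ∃ t : {t // Good (i + 1) t},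
      ∀ p, R.d (i + 1) (t.1 p) + s.1 (R.d i p) = p := by
    rintro i ⟨s, hs⟩
    obtain ⟨t, ht, ht'⟩ := exists_section_of_exact (k := k)
      (f := (R.d (i + 1)).restrictScalars k) (g := (R.d i).restrictScalars k) (R.exact_succ i) s hs
    exact ⟨⟨t, ht'⟩, ht⟩
  obtain ⟨h0, hh0, hg0⟩ := exists_section_of_exact (k := k) (f := (R.d 0).restrictScalars k)
    (g := R.ε.restrictScalars k) R.exact_zero σ fun v => hσ' _
  choose next hnext using step
  let hs : ∀ i, {s // Good i s} := fun i => Nat.rec ⟨h0, hg0⟩ next i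
  exact ⟨σ, fun i => (hs i).1, hσ', hh0, fun i p => hnext i (hs i) p⟩

end Homotopy

end GradedDet

namespace GradedDet

/-! ### The total complex of two resolutions -/

section TotalComplex

variable {k : Type v} [Field k] {A B : Type u} [Ring A] [Algebra k A] [Ring B] [Algebra k B]

attribute [local instance 50] tensorRightModule tensorRightModule_isScalarTower

variable {𝒜 : ℤ → Submodule k A} {ℬ : ℤ → Submodule k B} {X Y : Type u}
  [AddCommGroup X] [Module k X] [Module Aᵐᵒᵖ X] [IsScalarTower k Aᵐᵒᵖ X]
  [AddCommGroup Y] [Module k Y] [Module Bᵐᵒᵖ Y] [IsScalarTower k Bᵐᵒᵖ Y]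
  {𝒳 : ℤ → Submodule k X} {𝒴 : ℤ → Submodule k Y}
  (R : GradedProjectiveResolution 𝒜 𝒳) (S : GradedProjectiveResolution ℬ 𝒴)

/-- The `n`-th term of the total complex of the tensor product of two resolutions. -/
abbrev Total (n : ℕ) : Type u :=
  DirectSum {p : ℕ × ℕ // p.1 + p.2 = n} fun p => R.P p.1.1 ⊗[k] S.P p.1.2

namespace Total

variable {n : ℕ}

/-- The inclusion of a summand into the total complex. -/
noncomputable def incl (i j : ℕ) (h : i + j = n) :
    R.P i ⊗[k] S.P j →ₗ[(A ⊗[k] B)ᵐᵒᵖ] Total R S n :=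
  DirectSum.lof (A ⊗[k] B)ᵐᵒᵖ {p : ℕ × ℕ // p.1 + p.2 = n}
    (fun p => R.P p.1.1 ⊗[k] S.P p.1.2) ⟨(i, j), h⟩

variable {R S} in
theorem induction {motive : Total R S n → Prop} (zero : motive 0)
    (add : ∀ z w, motive z → motive w → motive (z + w))
    (incl : ∀ i j h x y, motive (incl R S i j h (x ⊗ₜ y))) (z : Total R S n) : motive z := by
  induction z using DirectSum.induction_on with
  | zero => exact zero
  | add z w hz hw => exact add z w hz hw
  | of p t =>
    obtain ⟨⟨i, j⟩, h⟩ := p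
    change motive (Total.incl R S i j h t)
    induction t with
    | zero => rwa [map_zero]
    | add z w hz hw => rw [map_add]; exact add _ _ hz hw
    | tmul x y => exact incl i j h x y

variable {R S} in
theorem incl_eq_lof (i j : ℕ) (h : i + j = n) (z : R.P i ⊗[k] S.P j) :
    incl R S i j h z = DirectSum.lof k {p : ℕ × ℕ // p.1 + p.2 = n}
      (fun p => R.P p.1.1 ⊗[k] S.P p.1.2) ⟨(i, j), h⟩ z := rfl

/-- The horizontal component of the differential. -/
noncomputable def left : ∀ i j : ℕ, i + j = n + 1 →
    (R.P i ⊗[k] S.P j →ₗ[(A ⊗[k] B)ᵐᵒᵖ] Total R S n)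
  | 0, _, _ => 0
  | i + 1, j, h => incl R S i j (by omega) ∘ₗ tensorMap (R.d i) LinearMap.id

/-- The vertical component of the differential, without its sign. -/
noncomputable def right : ∀ i j : ℕ, i + j = n + 1 →
    (R.P i ⊗[k] S.P j →ₗ[(A ⊗[k] B)ᵐᵒᵖ] Total R S n)
  | _, 0, _ => 0
  | i, j + 1, h => incl R S i j (by omega) ∘ₗ tensorMap LinearMap.id (S.d j)

/-- The differential of the total complex. -/
noncomputable def d (n : ℕ) : Total R S (n + 1) →ₗ[(A ⊗[k] B)ᵐᵒᵖ] Total R S n :=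
  DirectSum.toModule _ _ _ fun p =>
    left R S p.1.1 p.1.2 p.2 + (-1 : ℤ) ^ p.1.1 • right R S p.1.1 p.1.2 p.2

/-- A component of the augmentation of the total complex. -/
noncomputable def aug : ∀ i j : ℕ, i + j = 0 →
    (R.P i ⊗[k] S.P j →ₗ[(A ⊗[k] B)ᵐᵒᵖ] X ⊗[k] Y)
  | 0, 0, _ => tensorMap R.ε S.ε
  | i + 1, _, h => absurd h (by omega)
  | 0, j + 1, h => absurd h (by omega)

/-- The augmentation of the total complex. -/
noncomputable def ε : Total R S 0 →ₗ[(A ⊗[k] B)ᵐᵒᵖ] X ⊗[k] Y :=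
  DirectSum.toModule _ _ _ fun p => aug R S p.1.1 p.1.2 p.2

theorem d_incl (i j : ℕ) (h : i + j = n + 1) (z : R.P i ⊗[k] S.P j) :
    d R S n (incl R S i j h z) = left R S i j h z + (-1 : ℤ) ^ i • right R S i j h z := by
  rw [d, incl, DirectSum.toModule_lof, LinearMap.add_apply, LinearMap.smul_apply]

@[simp]
theorem ε_incl (x : R.P 0) (y : S.P 0) (h : 0 + 0 = 0) :
    ε R S (incl R S 0 0 h (x ⊗ₜ y)) = R.ε x ⊗ₜ[k] S.ε y := by
  rw [ε, incl, DirectSum.toModule_lof, aug, tensorMap_tmul]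

@[simp]
theorem d_incl_zero_succ (j : ℕ) (h : 0 + (j + 1) = n + 1) (x : R.P 0) (y : S.P (j + 1)) :
    d R S n (incl R S 0 (j + 1) h (x ⊗ₜ y)) = incl R S 0 j (by omega) (x ⊗ₜ S.d j y) := by
  simp [d_incl, left, right]

@[simp]
theorem d_incl_succ_zero (i : ℕ) (h : i + 1 + 0 = n + 1) (x : R.P (i + 1)) (y : S.P 0) :
    d R S n (incl R S (i + 1) 0 h (x ⊗ₜ y)) = incl R S i 0 (by omega) (R.d i x ⊗ₜ y) := by
  simp [d_incl, left, right]

@[simp]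
theorem d_incl_succ_succ (i j : ℕ) (h : i + 1 + (j + 1) = n + 1) (x : R.P (i + 1))
    (y : S.P (j + 1)) :
    d R S n (incl R S (i + 1) (j + 1) h (x ⊗ₜ y)) =
      incl R S i (j + 1) (by omega) (R.d i x ⊗ₜ y) -
        (-1 : ℤ) ^ i • incl R S (i + 1) j (by omega) (x ⊗ₜ S.d j y) := by
  simp [d_incl, left, right, pow_succ, sub_eq_add_neg]

theorem d_comp_d (z : Total R S (n + 2)) : d R S n (d R S (n + 1) z) = 0 := by
  induction z using Total.induction with
  | zero => simp
  | add z w hz hw => simp [hz, hw]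
  | incl i j h x y =>
    rcases i with _ | _ | i <;> rcases j with _ | _ | j <;> try omega
    all_goals simp [(R.exact_succ _).apply_apply_eq_zero, (S.exact_succ _).apply_apply_eq_zero,
      pow_succ]

theorem ε_comp_d (z : Total R S 1) : ε R S (d R S 0 z) = 0 := by
  induction z using Total.induction with
  | zero => simp
  | add z w hz hw => simp [hz, hw]
  | incl i j h x y =>
    rcases i with _ | _ | i <;> rcases j with _ | _ | j <;> try omega
    all_goals simp [R.exact_zero.apply_apply_eq_zero, S.exact_zero.apply_apply_eq_zero]

theorem ε_surjective : Function.Surjective (ε R S) := by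
  rw [← LinearMap.range_eq_top, Submodule.eq_top_iff']
  intro z
  induction z with
  | zero => exact zero_mem _
  | add z w hz hw => exact add_mem hz hw
  | tmul x y =>
    obtain ⟨x, rfl⟩ := R.ε_surjective x
    obtain ⟨y, rfl⟩ := S.ε_surjective y
    exact ⟨_, ε_incl R S x y rfl⟩

section Homotopy

variable {R S} (σ : X →ₗ[k] R.P 0) (r : ∀ i, R.P i →ₗ[k] R.P (i + 1))
  (s : ∀ i, S.P i →ₗ[k] S.P (i + 1))

/-- A component of the contracting homotopy of the total complex. -/
noncomputable def hom : ∀ i j : ℕ, i + j = n → (R.P i ⊗[k] S.P j →ₗ[k] Total R S (n + 1))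
  -- On `P 0` the contraction satisfies `d r = 1 - σε` rather than `d r = 1`. The missing part `σε ⊗
  -- 1` is contracted by `s` in the second factor, with no sign since `i = 0`.
  | 0, j, h => (incl R S 1 j (by omega)).restrictScalars k ∘ₗ TensorProduct.map (r 0) LinearMap.id +
      (incl R S 0 (j + 1) (by omega)).restrictScalars k ∘ₗ
        TensorProduct.map (σ ∘ₗ R.ε.restrictScalars k) (s j)
  | i + 1, j, h => (incl R S (i + 2) j (by omega)).restrictScalars k ∘ₗ
      TensorProduct.map (r (i + 1)) LinearMap.id

/-- The contracting homotopy of the total complex built from those of the factors. -/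
noncomputable def homotopy (n : ℕ) : Total R S n →ₗ[k] Total R S (n + 1) :=
  DirectSum.toModule _ _ _ fun p => hom σ r s p.1.1 p.1.2 p.2

theorem homotopy_incl (i j : ℕ) (h : i + j = n) (z : R.P i ⊗[k] S.P j) :
    homotopy σ r s n (incl R S i j h z) = hom σ r s i j h z := by
  rw [incl_eq_lof, homotopy, DirectSum.toModule_lof]

@[simp]
theorem homotopy_incl_zero (j : ℕ) (h : 0 + j = n) (x : R.P 0) (y : S.P j) :
    homotopy σ r s n (incl R S 0 j h (x ⊗ₜ y)) =
      incl R S 1 j (by omega) (r 0 x ⊗ₜ y) +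
        incl R S 0 (j + 1) (by omega) (σ (R.ε x) ⊗ₜ s j y) :=
  homotopy_incl σ r s 0 j h _

@[simp]
theorem homotopy_incl_succ (i j : ℕ) (h : i + 1 + j = n) (x : R.P (i + 1)) (y : S.P j) :
    homotopy σ r s n (incl R S (i + 1) j h (x ⊗ₜ y)) =
      incl R S (i + 2) j (by omega) (r (i + 1) x ⊗ₜ y) :=
  homotopy_incl σ r s (i + 1) j h _

end Homotopy

/-- The identity `d h + h d = 1` writes a cycle `z` as `d (h z)`. That `h` is only `k`-linear does
no harm. -/
theorem exact_succ (n : ℕ) : Function.Exact (d R S (n + 1)) (d R S n) := by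
  obtain ⟨σ, r, hσ, hr0, hr⟩ := R.exists_homotopy
  obtain ⟨τ, s, hτ, hs0, hs⟩ := S.exists_homotopy
  have key : ∀ z : Total R S (n + 1), d R S (n + 1) (homotopy σ r s (n + 1) z) +
      homotopy σ r s n (d R S n z) = z := by
    intro z
    induction z using Total.induction with
    | zero => simp
    | add z w hz hw =>
      conv_rhs => rw [← hz, ← hw]
      simp only [map_add]
      abel
    | incl i j h x y =>
      rcases i with _ | i <;> rcases j with _ | j
      · omega
      · have e : x ⊗ₜ[k] y = R.d 0 (r 0 x) ⊗ₜ[k] y + (σ (R.ε x) ⊗ₜ[k] S.d (j + 1) (s (j + 1) y) +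
            σ (R.ε x) ⊗ₜ[k] s j (S.d j y)) := by
          rw [← TensorProduct.tmul_add, hs, ← TensorProduct.add_tmul, hr0]
        conv_rhs => rw [e]
        simp only [homotopy_incl_zero, map_add, d_incl_succ_succ, d_incl_zero_succ, pow_zero,
          one_smul]
        abel
      · have e : x ⊗ₜ[k] y = R.d (i + 1) (r (i + 1) x) ⊗ₜ[k] y + r i (R.d i x) ⊗ₜ[k] y := by
          rw [← TensorProduct.add_tmul, hr]
        conv_rhs => rw [e]
        -- When the differential lands in the column `i = 0`, the homotopy contributes an extra term
        -- containing `ε (d 0 x)`, which vanishes.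
        rcases i with _ | i <;>
          simp [R.exact_zero.apply_apply_eq_zero]
      · have e : x ⊗ₜ[k] y = R.d (i + 1) (r (i + 1) x) ⊗ₜ[k] y + r i (R.d i x) ⊗ₜ[k] y := by
          rw [← TensorProduct.add_tmul, hr]
        conv_rhs => rw [e]
        rcases i with _ | i <;>
          simp [R.exact_zero.apply_apply_eq_zero, pow_succ]
  refine fun z => ⟨fun hz => ⟨homotopy σ r s (n + 1) z, ?_⟩, ?_⟩
  · have := key z
    rwa [hz, map_zero, add_zero] at this
  · rintro ⟨w, rfl⟩
    exact d_comp_d R S w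

/-- At the end of the complex `d h` differs from the identity by `(σ ⊗ τ) ∘ ε`, which kills the
kernel of `ε`. -/
theorem exact_zero : Function.Exact (d R S 0) (ε R S) := by
  obtain ⟨σ, r, hσ, hr0, hr⟩ := R.exists_homotopy
  obtain ⟨τ, s, hτ, hs0, hs⟩ := S.exists_homotopy
  have key : ∀ z : Total R S 0, d R S 0 (homotopy σ r s 0 z) +
      incl R S 0 0 rfl (TensorProduct.map σ τ (ε R S z)) = z := by
    intro z
    induction z using Total.induction with
    | zero => simp
    | add z w hz hw =>
      conv_rhs => rw [← hz, ← hw]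
      simp only [map_add]
      abel
    | incl i j h x y =>
      obtain ⟨rfl, rfl⟩ : i = 0 ∧ j = 0 := by omega
      simp only [homotopy_incl_zero, map_add, d_incl_succ_zero, d_incl_zero_succ, ε_incl,
        TensorProduct.map_tmul]
      rw [add_assoc, ← map_add, ← TensorProduct.tmul_add, hs0, ← map_add,
        ← TensorProduct.add_tmul, hr0]
  refine fun z => ⟨fun hz => ⟨homotopy σ r s 0 z, ?_⟩, ?_⟩
  · have := key z
    rwa [hz, map_zero, map_zero, add_zero] at this
  · rintro ⟨w, rfl⟩
    exact ε_comp_d R S w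

/-- The degree `m` component of the `n`-th term of the total complex. -/
def deg (n : ℕ) : ℤ → Submodule k (Total R S n) :=
  sumGrading fun p => tensorGrading (R.deg p.1.1) (S.deg p.1.2)

theorem incl_mem_deg {i j : ℕ} (h : i + j = n) {a b m : ℤ} (hab : a + b = m) {x : R.P i}
    {y : S.P j} (hx : x ∈ R.deg i a) (hy : y ∈ S.deg j b) :
    incl R S i j h (x ⊗ₜ y) ∈ deg R S n m := by
  have hz := tmul_mem_tensorGrading hab hx hy
  rw [incl_eq_lof]
  exact lof_mem_sumGrading hz

variable {R S} in
theorem deg_le {m : ℤ} {N : Submodule k (Total R S n)}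
    (hN : ∀ i j h a b, a + b = m → ∀ x ∈ R.deg i a, ∀ y ∈ S.deg j b,
      incl R S i j h (x ⊗ₜ y) ∈ N) : deg R S n m ≤ N := by
  refine sumGrading_induction ?_
  rintro ⟨⟨i, j⟩, h⟩ z hz
  have := tensorGrading_le (n := m) (N := N.comap ((incl R S i j h).restrictScalars k))
    fun a b hab x hx y hy => hN i j h a b hab x hx y hy
  exact this hz

theorem d_mem (n : ℕ) (m : ℤ) : deg R S (n + 1) m ≤ (deg R S n m).comap
    ((d R S n).restrictScalars k) := by
  refine deg_le fun i j h a b hab x hx y hy => ?_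
  change d R S n (incl R S i j h (x ⊗ₜ y)) ∈ deg R S n m
  rcases i with _ | i <;> rcases j with _ | j
  · omega
  · rw [d_incl_zero_succ]
    exact incl_mem_deg R S _ hab hx (S.d_mem _ _ _ hy)
  · rw [d_incl_succ_zero]
    exact incl_mem_deg R S _ hab (R.d_mem _ _ _ hx) hy
  · rw [d_incl_succ_succ]
    exact sub_mem (incl_mem_deg R S _ hab (R.d_mem _ _ _ hx) hy)
      (zsmul_mem (incl_mem_deg R S _ hab hx (S.d_mem _ _ _ hy)) _)

theorem ε_mem (m : ℤ) : deg R S 0 m ≤ (tensorGrading 𝒳 𝒴 m).comap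
    ((ε R S).restrictScalars k) := by
  refine deg_le fun i j h a b hab x hx y hy => ?_
  obtain ⟨rfl, rfl⟩ : i = 0 ∧ j = 0 := by omega
  change ε R S (incl R S 0 0 h (x ⊗ₜ y)) ∈ tensorGrading 𝒳 𝒴 m
  rw [ε_incl]
  exact tmul_mem_tensorGrading hab (R.ε_mem _ _ hx) (S.ε_mem _ _ hy)

/-- The total complex as a graded projective resolution of the tensor product. -/
noncomputable def resolution :
    GradedProjectiveResolution (tensorGrading 𝒜 ℬ) (tensorGrading 𝒳 𝒴) where
  P := Total R S
  deg := deg R S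
  graded n := isGradedModule_sum fun p => isGradedModule_tensor (R.graded _) (S.graded _)
  projective n := by
    have := R.projective
    have := S.projective
    have := fun p : {p : ℕ × ℕ // p.1 + p.2 = n} =>
      projective_tensor (k := k) (A := A) (B := B) (X := R.P p.1.1) (Y := S.P p.1.2)
    exact Module.Projective.directSum
  d := d R S
  d_mem n m _ hz := d_mem R S n m hz
  ε := ε R S
  ε_mem m _ hz := ε_mem R S m hz
  ε_surjective := ε_surjective R S
  exact_zero := exact_zero R S
  exact_succ := exact_succ R S

theorem span_deg {𝒮 ℛ : ℕ → Set ℤ}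
    (h𝒮 : ∀ i, Submodule.span Aᵐᵒᵖ (⋃ j ∈ 𝒮 i, (R.deg i j : Set (R.P i))) = ⊤)
    (hℛ : ∀ i, Submodule.span Bᵐᵒᵖ (⋃ j ∈ ℛ i, (S.deg i j : Set (S.P i))) = ⊤) (n : ℕ) :
    Submodule.span (A ⊗[k] B)ᵐᵒᵖ
      (⋃ j ∈ tensorDegrees 𝒮 ℛ n, (deg R S n j : Set (Total R S n))) = ⊤ := by
  refine Submodule.eq_top_iff'.2 fun z => ?_
  induction z using Total.induction with
  | zero => exact zero_mem _
  | add z w hz hw => exact add_mem hz hw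
  | incl i j h x y =>
    -- Generation is checked inside the summand: the generating set is pulled back along `incl` and
    -- compared with tensors of generators of the two factors.
    have := span_tensor (k := k) (h𝒮 i) (hℛ j) (W := (incl R S i j h) ⁻¹'
      (⋃ j ∈ tensorDegrees 𝒮 ℛ n, (deg R S n j : Set (Total R S n)))) (by
        intro x hx y hy
        simp only [Set.mem_iUnion, SetLike.mem_coe, exists_prop, Set.mem_preimage] at hx hy ⊢
        obtain ⟨a, ha, hx⟩ := hx
        obtain ⟨b, hb, hy⟩ := hy
        exact ⟨a + b, ⟨i, j, h, a, ha, b, hb, rfl⟩, incl_mem_deg R S h rfl hx hy⟩)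
    have hxy : x ⊗ₜ[k] y ∈ (⊤ : Submodule (A ⊗[k] B)ᵐᵒᵖ _) := Submodule.mem_top
    rw [← this] at hxy
    have := Submodule.span_preimage_le _ _ hxy
    exact this

end Total

theorem isDetermined_tensor {𝒮 ℛ : ℕ → Set ℤ} (h𝒳 : IsDetermined 𝒜 𝒳 𝒮)
    (h𝒴 : IsDetermined ℬ 𝒴 ℛ) : IsDetermined (tensorGrading 𝒜 ℬ) (tensorGrading 𝒳 𝒴)
      (tensorDegrees 𝒮 ℛ) := by
  obtain ⟨h𝒳, R, hR⟩ := h𝒳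
  obtain ⟨h𝒴, S, hS⟩ := h𝒴
  exact ⟨isGradedModule_tensor h𝒳 h𝒴, Total.resolution R S, Total.span_deg R S hR hS⟩

end TotalComplex

end GradedDet

namespace GradedDet

/-! ### Stability of the class of algebras under tensor product -/

section QuiverGraded

variable {k : Type v} [Field k] {A B : Type u} [Ring A] [Algebra k A] [Ring B] [Algebra k B]
  {𝒜 : ℤ → Submodule k A} {ℬ : ℤ → Submodule k B}

theorem gradedMonoid_tensor [SetLike.GradedMonoid 𝒜] [SetLike.GradedMonoid ℬ] :
    SetLike.GradedMonoid (tensorGrading 𝒜 ℬ) where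
  one_mem := tmul_mem_tensorGrading (add_zero 0) SetLike.GradedOne.one_mem
    SetLike.GradedOne.one_mem
  mul_mem := by
    intro i j z w hz hw
    induction hz using Submodule.span_induction with
    | zero => simp
    | add c d _ _ h h' => rw [add_mul]; exact add_mem h h'
    | smul r c _ h => rw [smul_mul_assoc]; exact Submodule.smul_mem _ _ h
    | mem c hc =>
      obtain ⟨m, n, rfl, a, ha, b, hb, rfl⟩ := hc
      induction hw using Submodule.span_induction with
      | zero => simp
      | add c d _ _ h h' => rw [mul_add]; exact add_mem h h'
      | smul r c _ h => rw [mul_smul_comm]; exact Submodule.smul_mem _ _ h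
      | mem z hz =>
        obtain ⟨m', n', rfl, x, hx, y, hy, rfl⟩ := hz
        rw [Algebra.TensorProduct.tmul_mul_tmul]
        exact tmul_mem_tensorGrading (by ring) (SetLike.GradedMul.mul_mem ha hx)
          (SetLike.GradedMul.mul_mem hb hy)

theorem tensorGrading_of_neg (hA : ∀ i < 0, 𝒜 i = ⊥) (hB : ∀ i < 0, ℬ i = ⊥) {n : ℤ}
    (hn : n < 0) : tensorGrading 𝒜 ℬ n = ⊥ := by
  refine eq_bot_iff.2 (tensorGrading_le fun i j hij x hx y hy => ?_)
  rcases lt_or_ge i 0 with hi | hi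
  · rw [hA i hi, Submodule.mem_bot] at hx
    simp [hx]
  · rw [hB j (by omega), Submodule.mem_bot] at hy
    simp [hy]

/-- The tensor product of two finite powers of the base field. -/
noncomputable def powTensorPow (k : Type v) [Field k] (n m : ℕ) :
    ((Fin n → k) ⊗[k] (Fin m → k)) ≃ₐ[k] (Fin (m * n) → k) :=
  -- This step yields functions on `Fin m` with values in `Fin n → k`, whence the order of the
  -- factors in `m * n`.
  (Algebra.TensorProduct.piScalarRight k k (Fin n → k) (Fin m)).trans
    { toFun := fun f p => f (finProdFinEquiv.symm p).1 (finProdFinEquiv.symm p).2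
      invFun := fun f i j => f (finProdFinEquiv (i, j))
      left_inv := fun f => by simp
      right_inv := fun f => funext fun p => congrArg f (finProdFinEquiv.apply_symm_apply p)
      map_mul' := fun _ _ => rfl
      map_add' := fun _ _ => rfl
      commutes' := fun _ => rfl }

/-- By non-negativity `i + j = 0` contributes only for `i = j = 0`, so the degree zero part is the
image of `A_0 ⊗ B_0`. The map from `A_0 ⊗ B_0` is injective by flatness over a field. -/
theorem degree_zero_tensor [SetLike.GradedMonoid 𝒜] [SetLike.GradedMonoid ℬ]
    [SetLike.GradedMonoid (tensorGrading 𝒜 ℬ)] (hA : ∀ i < 0, 𝒜 i = ⊥) (hB : ∀ i < 0, ℬ i = ⊥)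
    {n m : ℕ} (e : 𝒜 0 ≃ₐ[k] (Fin n → k)) (f : ℬ 0 ≃ₐ[k] (Fin m → k)) :
    Nonempty (tensorGrading 𝒜 ℬ 0 ≃ₐ[k] (Fin (m * n) → k)) := by
  let φ : (SetLike.GradeZero.subalgebra 𝒜 ⊗[k] SetLike.GradeZero.subalgebra ℬ) →ₐ[k] A ⊗[k] B :=
    Algebra.TensorProduct.map (SetLike.GradeZero.subalgebra 𝒜).val
      (SetLike.GradeZero.subalgebra ℬ).val
  have hφ : Function.Injective φ :=
    TensorProduct.map_injective_of_flat_flat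
      (SetLike.GradeZero.subalgebra 𝒜).val.toLinearMap
      (SetLike.GradeZero.subalgebra ℬ).val.toLinearMap Subtype.val_injective Subtype.val_injective
  have hrange : φ.range = SetLike.GradeZero.subalgebra (tensorGrading 𝒜 ℬ) := by
    apply le_antisymm
    · rintro _ ⟨z, rfl⟩
      induction z with
      | zero => simp
      | add z w hz hw => rw [map_add]; exact add_mem hz hw
      | tmul x y => exact tmul_mem_tensorGrading (add_zero 0) x.2 y.2
    · refine tensorGrading_le (N := Subalgebra.toSubmodule φ.range) fun i j hij x hx y hy => ?_
      rcases lt_trichotomy i 0 with hi | rfl | hi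
      · rw [hA i hi, Submodule.mem_bot] at hx
        simp [hx]
      · obtain rfl : j = 0 := by omega
        exact ⟨(⟨x, hx⟩ : SetLike.GradeZero.subalgebra 𝒜) ⊗ₜ
          (⟨y, hy⟩ : SetLike.GradeZero.subalgebra ℬ), rfl⟩
      · rw [hB j (by omega), Submodule.mem_bot] at hy
        simp [hy]
  have e' : SetLike.GradeZero.subalgebra 𝒜 ≃ₐ[k] (Fin n → k) := e
  have f' : SetLike.GradeZero.subalgebra ℬ ≃ₐ[k] (Fin m → k) := f
  exact ⟨(((Subalgebra.equivOfEq _ _ hrange).symm.trans (AlgEquiv.ofInjective φ hφ).symm).trans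
    (Algebra.TensorProduct.congr e' f')).trans (powTensorPow k n m)⟩

theorem isQuiverGraded_tensor (hA : IsQuiverGraded 𝒜) (hB : IsQuiverGraded ℬ) :
    IsQuiverGraded (tensorGrading 𝒜 ℬ) := by
  have := hA.toGradedMonoid
  have := hB.toGradedMonoid
  obtain ⟨n, ⟨e⟩⟩ := hA.degree_zero
  obtain ⟨m, ⟨f⟩⟩ := hB.degree_zero
  refine { gradedMonoid_tensor with
    isInternal := isInternal_tensorGrading hA.isInternal hB.isInternal
    nonneg := fun i hi => tensorGrading_of_neg hA.nonneg hB.nonneg hi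
    degree_zero := ?_
    finite_degree_one := ?_
    generated := ?_ }
  · have := gradedMonoid_tensor (𝒜 := 𝒜) (ℬ := ℬ)
    exact ⟨_, degree_zero_tensor hA.nonneg hB.nonneg e f⟩
  · have := hA.finite_degree_one
    have := hB.finite_degree_one
    have : Module.Finite k (𝒜 0) := Module.Finite.equiv e.symm.toLinearEquiv
    have : Module.Finite k (ℬ 0) := Module.Finite.equiv f.symm.toLinearEquiv
    have hle : tensorGrading 𝒜 ℬ 1 ≤
        LinearMap.range (TensorProduct.map (𝒜 0).subtype (ℬ 1).subtype) ⊔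
          LinearMap.range (TensorProduct.map (𝒜 1).subtype (ℬ 0).subtype) := by
      refine tensorGrading_le fun i j hij x hx y hy => ?_
      rcases lt_or_ge i 0 with hi | hi
      · rw [hA.nonneg i hi, Submodule.mem_bot] at hx
        simp [hx]
      rcases lt_or_ge j 0 with hj | hj
      · rw [hB.nonneg j hj, Submodule.mem_bot] at hy
        simp [hy]
      obtain rfl | rfl : i = 0 ∨ i = 1 := by omega
      · obtain rfl : j = 1 := by omega
        exact Submodule.mem_sup_left ⟨(⟨x, hx⟩ : 𝒜 0) ⊗ₜ (⟨y, hy⟩ : ℬ 1), rfl⟩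
      · obtain rfl : j = 0 := by omega
        exact Submodule.mem_sup_right ⟨(⟨x, hx⟩ : 𝒜 1) ⊗ₜ (⟨y, hy⟩ : ℬ 0), rfl⟩
    exact Submodule.finiteDimensional_of_le hle
  · set G := Algebra.adjoin k
      ((tensorGrading 𝒜 ℬ 0 : Set (A ⊗[k] B)) ∪ (tensorGrading 𝒜 ℬ 1 : Set (A ⊗[k] B))) with hG
    have hleft : (⊤ : Subalgebra k A) ≤ G.comap
        (Algebra.TensorProduct.includeLeft : A →ₐ[k] A ⊗[k] B) := by
      rw [← hA.generated, Algebra.adjoin_le_iff]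
      rintro a (ha | ha)
      · exact Algebra.subset_adjoin (Or.inl (tmul_mem_tensorGrading (add_zero 0) ha
          SetLike.GradedOne.one_mem))
      · exact Algebra.subset_adjoin (Or.inr (tmul_mem_tensorGrading (add_zero 1) ha
          SetLike.GradedOne.one_mem))
    have hright : (⊤ : Subalgebra k B) ≤ G.comap
        (Algebra.TensorProduct.includeRight : B →ₐ[k] A ⊗[k] B) := by
      rw [← hB.generated, Algebra.adjoin_le_iff]
      rintro a (ha | ha)
      · exact Algebra.subset_adjoin (Or.inl (tmul_mem_tensorGrading (add_zero 0)
          SetLike.GradedOne.one_mem ha))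
      · exact Algebra.subset_adjoin (Or.inr (tmul_mem_tensorGrading (zero_add 1)
          SetLike.GradedOne.one_mem ha))
    refine eq_top_iff.2 fun z _ => ?_
    induction z with
    | zero => exact zero_mem _
    | add z w hz hw => exact add_mem (hz trivial) (hw trivial)
    | tmul a b =>
      -- `a ⊗ b = (a ⊗ 1)(1 ⊗ b)`, and both factors come from generated algebras embedded with the
      -- degrees of their generators unchanged.
      have ha : a ⊗ₜ[k] (1 : B) ∈ G := hleft Algebra.mem_top
      have hb : (1 : A) ⊗ₜ[k] b ∈ G := hright Algebra.mem_top
      have := mul_mem ha hb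
      rwa [Algebra.TensorProduct.tmul_mul_tmul, mul_one, one_mul] at this

end QuiverGraded

/-! ### Enlarging the degree sets and transport along isomorphisms -/

section Transport

variable {k : Type v} [Field k] {A : Type u} [Ring A] [Algebra k A] {𝒜 : ℤ → Submodule k A}
  {X : Type u} [AddCommGroup X] [Module k X] [Module Aᵐᵒᵖ X] [IsScalarTower k Aᵐᵒᵖ X]
  {Y : Type u} [AddCommGroup Y] [Module k Y] [Module Aᵐᵒᵖ Y] [IsScalarTower k Aᵐᵒᵖ Y]
  {𝒳 : ℤ → Submodule k X} {𝒴 : ℤ → Submodule k Y} {𝒮 ℛ : ℕ → Set ℤ}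

theorem IsDetermined.mono (h : IsDetermined 𝒜 𝒳 𝒮) (h𝒮 : ∀ i, 𝒮 i ⊆ ℛ i) :
    IsDetermined 𝒜 𝒳 ℛ := by
  obtain ⟨h, R, hR⟩ := h
  exact ⟨h, R, fun i => top_le_iff.1 ((hR i).symm.le.trans
    (Submodule.span_mono (Set.biUnion_subset_biUnion_left (h𝒮 i))))⟩

/-- The resolution is kept and only its augmentation is composed with `e`. -/
theorem IsDetermined.of_equiv (h : IsDetermined 𝒜 𝒳 𝒮) (e : X ≃ₗ[Aᵐᵒᵖ] Y)
    (he : ∀ n, 𝒴 n = (𝒳 n).map (e.toLinearMap.restrictScalars k)) : IsDetermined 𝒜 𝒴 𝒮 := by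
  obtain ⟨h, R, hR⟩ := h
  refine ⟨⟨?_, ?_⟩, { R with
    ε := e.toLinearMap ∘ₗ R.ε
    ε_mem := fun n x hx => ?_
    ε_surjective := e.surjective.comp R.ε_surjective
    exact_zero := fun x => ?_ }, hR⟩
  · have h𝒳 := (DirectSum.isInternal_submodule_iff_iSupIndep_and_iSup_eq_top _).1 h.isInternal
    let e' : X ≃ₗ[k] Y := e.restrictScalars k
    have he' : 𝒴 = fun n => Submodule.orderIsoMapComap e' (𝒳 n) := funext he
    rw [DirectSum.isInternal_submodule_iff_iSupIndep_and_iSup_eq_top, he']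
    refine ⟨h𝒳.1.map_orderIso (Submodule.orderIsoMapComap e'), ?_⟩
    rw [← OrderIso.map_iSup, h𝒳.2, OrderIso.map_top]
  · intro j i y a hy ha
    rw [he] at hy ⊢
    obtain ⟨x, hx, rfl⟩ := hy
    exact ⟨_, h.smul_mem j i x a hx ha, map_smul e _ _⟩
  · rw [he]
    exact ⟨_, R.ε_mem n x hx, rfl⟩
  · simpa using R.exact_zero x

end Transport

/-- The kernel of a tensor product of surjective maps is spanned by the tensors with a factor in
one of the kernels. -/
theorem ker_map_le {k : Type v} [Field k] {U V U' V' : Type u} [AddCommGroup U] [Module k U]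
    [AddCommGroup V] [Module k V] [AddCommGroup U'] [Module k U'] [AddCommGroup V'] [Module k V']
    {g : U →ₗ[k] V} {g' : U' →ₗ[k] V'} {N : Submodule k (U ⊗[k] U')}
    (hg : Function.Surjective g) (hg' : Function.Surjective g')
    (h : ∀ x ∈ LinearMap.ker g, ∀ y, x ⊗ₜ[k] y ∈ N)
    (h' : ∀ x, ∀ y ∈ LinearMap.ker g', x ⊗ₜ[k] y ∈ N) :
    LinearMap.ker (TensorProduct.map g g') ≤ N := by
  rw [TensorProduct.map_ker (f := (LinearMap.ker g).subtype) (f' := (LinearMap.ker g').subtype)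
    (LinearMap.exact_subtype_ker_map g) hg (LinearMap.exact_subtype_ker_map g') hg']
  refine sup_le ?_ ?_
  · rintro _ ⟨w, rfl⟩
    induction w with
    | zero => simp
    | add z w hz hw => rw [map_add]; exact add_mem hz hw
    | tmul a b => exact h' a _ b.2
  · rintro _ ⟨w, rfl⟩
    induction w with
    | zero => simp
    | add z w hz hw => rw [map_add]; exact add_mem hz hw
    | tmul a b => exact h _ a.2 b

/-! ### The degree zero quotient of `A ⊗ B` -/

section DegreeZeroTensor

variable {k : Type v} [Field k] {A B : Type u} [Ring A] [Algebra k A] [Ring B] [Algebra k B]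

attribute [local instance 50] tensorRightModule tensorRightModule_isScalarTower

variable {𝒜 : ℤ → Submodule k A} {ℬ : ℤ → Submodule k B}

variable (𝒜 ℬ) in
/-- The projection of `A ⊗ B` onto `A_0 ⊗ B_0`. -/
noncomputable def degreeZeroProj :
    (A ⊗[k] B) →ₗ[(A ⊗[k] B)ᵐᵒᵖ] DegreeZero 𝒜 ⊗[k] DegreeZero ℬ where
  -- The source carries the regular right module structure of `A ⊗ B`, so linearity is checked by
  -- hand against multiplication.
  toFun := TensorProduct.map ((positivePart 𝒜).mkQ.restrictScalars k)
    ((positivePart ℬ).mkQ.restrictScalars k)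
  map_add' := map_add _
  map_smul' := by
    intro c z
    obtain ⟨c, rfl⟩ := op_surjective c
    rw [op_smul_eq_mul, RingHom.id_apply]
    induction z with
    | zero => simp
    | add z w hz hw => simp only [smul_add, map_add, add_mul, hz, hw]
    | tmul x y =>
      induction c with
      | zero => simp
      | add c d hc hd => simp only [op_add, add_smul, map_add, mul_add, hc, hd]
      | tmul a b =>
        rw [Algebra.TensorProduct.tmul_mul_tmul, TensorProduct.map_tmul, TensorProduct.map_tmul,
          op_tmul_smul_tmul]
        rfl

theorem degreeZeroProj_tmul (a : A) (b : B) :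
    degreeZeroProj 𝒜 ℬ (a ⊗ₜ b) = (positivePart 𝒜).mkQ a ⊗ₜ[k] (positivePart ℬ).mkQ b := rfl

theorem degreeZeroProj_surjective : Function.Surjective (degreeZeroProj 𝒜 ℬ) :=
  TensorProduct.map_surjective (Submodule.mkQ_surjective (positivePart 𝒜))
    (Submodule.mkQ_surjective (positivePart ℬ))

/-- The kernel is `A_{>0} ⊗ B + A ⊗ B_{>0}`. It contains every homogeneous tensor of positive
degree, since `i + j > 0` forces `i > 0` or `j > 0`. -/
theorem ker_degreeZeroProj (hA : IsQuiverGraded 𝒜) (hB : IsQuiverGraded ℬ) :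
    LinearMap.ker (degreeZeroProj 𝒜 ℬ) = positivePart (tensorGrading 𝒜 ℬ) := by
  have hA1 : (1 : A) ∈ 𝒜 0 := hA.one_mem
  have hB1 : (1 : B) ∈ ℬ 0 := hB.one_mem
  have hleft : ∀ a ∈ positivePart 𝒜, ∀ b : B, a ⊗ₜ[k] b ∈ positivePart (tensorGrading 𝒜 ℬ) := by
    intro a ha b
    induction ha using Submodule.span_induction with
    | zero => simp
    | add x y _ _ hx hy => rw [TensorProduct.add_tmul]; exact add_mem hx hy
    | smul r x _ hx =>
      have := Submodule.smul_mem _ (op (r.unop ⊗ₜ[k] (1 : B))) hx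
      rwa [op_smul_eq_mul, Algebra.TensorProduct.tmul_mul_tmul, mul_one] at this
    | mem x hx =>
      simp only [Set.mem_iUnion, SetLike.mem_coe, exists_prop] at hx
      obtain ⟨i, hi, hx⟩ := hx
      -- Since `b` need not be homogeneous, `x ⊗ b` is written as `(x ⊗ 1)(1 ⊗ b)`, where `x ⊗ 1` is
      -- homogeneous of degree `i > 0`.
      have := Submodule.smul_mem (positivePart (tensorGrading 𝒜 ℬ)) (op ((1 : A) ⊗ₜ[k] b))
        (Submodule.subset_span (Set.mem_biUnion hi (tmul_mem_tensorGrading (add_zero i) hx hB1)))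
      rwa [op_smul_eq_mul, Algebra.TensorProduct.tmul_mul_tmul, one_mul, mul_one] at this
  have hright : ∀ b ∈ positivePart ℬ, ∀ a : A, a ⊗ₜ[k] b ∈ positivePart (tensorGrading 𝒜 ℬ) := by
    intro b hb a
    induction hb using Submodule.span_induction with
    | zero => simp
    | add x y _ _ hx hy => rw [TensorProduct.tmul_add]; exact add_mem hx hy
    | smul r x _ hx =>
      have := Submodule.smul_mem _ (op ((1 : A) ⊗ₜ[k] r.unop)) hx
      rwa [op_smul_eq_mul, Algebra.TensorProduct.tmul_mul_tmul, mul_one] at this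
    | mem x hx =>
      simp only [Set.mem_iUnion, SetLike.mem_coe, exists_prop] at hx
      obtain ⟨i, hi, hx⟩ := hx
      have := Submodule.smul_mem (positivePart (tensorGrading 𝒜 ℬ)) (op (a ⊗ₜ[k] (1 : B)))
        (Submodule.subset_span (Set.mem_biUnion hi (tmul_mem_tensorGrading (zero_add i) hA1 hx)))
      rwa [op_smul_eq_mul, Algebra.TensorProduct.tmul_mul_tmul, mul_one, one_mul] at this
  apply le_antisymm
  · have hle : LinearMap.ker (TensorProduct.map ((positivePart 𝒜).mkQ.restrictScalars k)
        ((positivePart ℬ).mkQ.restrictScalars k)) ≤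
        (positivePart (tensorGrading 𝒜 ℬ)).restrictScalars k := by
      refine ker_map_le (Submodule.mkQ_surjective (positivePart 𝒜))
        (Submodule.mkQ_surjective (positivePart ℬ)) ?_ ?_
      · intro a ha b
        rw [LinearMap.mem_ker, LinearMap.restrictScalars_apply, Submodule.mkQ_apply,
          Submodule.Quotient.mk_eq_zero] at ha
        exact hleft a ha b
      · intro a b hb
        rw [LinearMap.mem_ker, LinearMap.restrictScalars_apply, Submodule.mkQ_apply,
          Submodule.Quotient.mk_eq_zero] at hb
        exact hright b hb a
    intro z hz
    exact hle hz
  · refine Submodule.span_le.2 (Set.iUnion₂_subset fun n hn => ?_)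
    refine tensorGrading_le (N := (LinearMap.ker (degreeZeroProj 𝒜 ℬ)).restrictScalars k)
      fun i j hij a ha b hb => ?_
    change degreeZeroProj 𝒜 ℬ (a ⊗ₜ b) = 0
    rw [degreeZeroProj_tmul]
    rcases lt_or_ge 0 i with hi | hi
    · rw [Submodule.mkQ_apply, (Submodule.Quotient.mk_eq_zero _).2, TensorProduct.zero_tmul]
      exact Submodule.subset_span (Set.mem_biUnion hi ha)
    · rw [Submodule.mkQ_apply (positivePart ℬ), (Submodule.Quotient.mk_eq_zero (positivePart ℬ)).2,
        TensorProduct.tmul_zero]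
      exact Submodule.subset_span (Set.mem_biUnion (show j > 0 by omega) hb)

/-- The degree zero part of `A ⊗ B` is the tensor product of the degree zero parts. -/
noncomputable def degreeZeroEquiv (hA : IsQuiverGraded 𝒜) (hB : IsQuiverGraded ℬ) :
    (DegreeZero 𝒜 ⊗[k] DegreeZero ℬ) ≃ₗ[(A ⊗[k] B)ᵐᵒᵖ] DegreeZero (tensorGrading 𝒜 ℬ) :=
  ((Submodule.quotEquivOfEq _ _ (ker_degreeZeroProj hA hB).symm).trans
    (LinearMap.quotKerEquivOfSurjective _ degreeZeroProj_surjective)).symm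

theorem degreeZeroEquiv_tmul (hA : IsQuiverGraded 𝒜) (hB : IsQuiverGraded ℬ) (a : A) (b : B) :
    degreeZeroEquiv hA hB ((positivePart 𝒜).mkQ a ⊗ₜ[k] (positivePart ℬ).mkQ b) =
      (positivePart (tensorGrading 𝒜 ℬ)).mkQ (a ⊗ₜ b) := by
  rw [degreeZeroEquiv, LinearEquiv.symm_apply_eq]
  rfl

theorem degreeZeroGrading_tensor (hA : IsQuiverGraded 𝒜) (hB : IsQuiverGraded ℬ) (n : ℤ) :
    degreeZeroGrading (tensorGrading 𝒜 ℬ) n =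
      (tensorGrading (degreeZeroGrading 𝒜) (degreeZeroGrading ℬ) n).map
        ((degreeZeroEquiv hA hB).toLinearMap.restrictScalars k) := by
  apply le_antisymm
  · refine Submodule.map_le_iff_le_comap.2 (tensorGrading_le fun i j hij a ha b hb => ?_)
    exact ⟨(positivePart 𝒜).mkQ a ⊗ₜ[k] (positivePart ℬ).mkQ b,
      tmul_mem_tensorGrading hij ⟨a, ha, rfl⟩ ⟨b, hb, rfl⟩, degreeZeroEquiv_tmul hA hB a b⟩
  · refine Submodule.map_le_iff_le_comap.2 (tensorGrading_le fun i j hij x hx y hy => ?_)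
    obtain ⟨a, ha, rfl⟩ := hx
    obtain ⟨b, hb, rfl⟩ := hy
    exact ⟨a ⊗ₜ b, tmul_mem_tensorGrading hij ha hb, (degreeZeroEquiv_tmul hA hB a b).symm⟩

theorem isDetermined_degreeZero_tensor (hA : IsQuiverGraded 𝒜) (hB : IsQuiverGraded ℬ)
    {𝒮 ℛ : ℕ → Set ℤ} (h𝒜 : IsDetermined 𝒜 (degreeZeroGrading 𝒜) 𝒮)
    (hℬ : IsDetermined ℬ (degreeZeroGrading ℬ) ℛ) :
    IsDetermined (tensorGrading 𝒜 ℬ) (degreeZeroGrading (tensorGrading 𝒜 ℬ))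
      (tensorDegrees 𝒮 ℛ) :=
  (isDetermined_tensor h𝒜 hℬ).of_equiv (degreeZeroEquiv hA hB)
    (degreeZeroGrading_tensor hA hB)

end DegreeZeroTensor

/-- Equality holds unless `i = 2m + 1` and `j = 2l + 1` are both odd. Then the sides are `(m + l)s +
2` and `(m + l + 1)s`, and `2 ≤ s` is what is needed. -/
theorem chi_add_le {s : ℕ} (hs : 2 ≤ s) (i j : ℕ) : chi s i + chi s j ≤ chi s (i + j) := by
  have even : ∀ m : ℕ, chi s (2 * m) = m * s := by
    intro m
    rw [chi, if_pos (even_two_mul m)]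
    push_cast
    rw [mul_assoc, Int.mul_ediv_cancel_left _ two_ne_zero]
  have odd : ∀ m : ℕ, chi s (2 * m + 1) = m * s + 1 := by
    intro m
    rw [chi, if_neg (Nat.not_even_two_mul_add_one m)]
    push_cast
    rw [add_sub_cancel_right, mul_assoc, Int.mul_ediv_cancel_left _ two_ne_zero]
  obtain ⟨m, rfl | rfl⟩ := i.even_or_odd'
  · obtain ⟨l, rfl | rfl⟩ := j.even_or_odd'
    · rw [← mul_add, even, even, even]
      push_cast
      linarith
    · rw [← add_assoc, ← mul_add, even, odd, odd]
      push_cast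
      linarith
  · obtain ⟨l, rfl | rfl⟩ := j.even_or_odd'
    · rw [add_right_comm, ← mul_add, even, odd, odd]
      push_cast
      linarith
    · rw [show 2 * m + 1 + (2 * l + 1) = 2 * (m + l + 1) by ring, even, odd, odd]
      push_cast
      linarith [(Nat.cast_le (α := ℤ)).2 hs]

end GradedDet

theorem mainTheorem6 {k : Type v} [Field k] {A B : Type u} [Ring A] [Algebra k A] [Ring B]
    [Algebra k B] (𝒜 : ℤ → Submodule k A) (ℬ : ℤ → Submodule k B)
    (hA : GradedDet.IsQuiverGraded 𝒜) (hB : GradedDet.IsQuiverGraded ℬ) :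
    (∀ (X Y : Type u) [AddCommGroup X] [Module k X] [Module Aᵐᵒᵖ X] [IsScalarTower k Aᵐᵒᵖ X]
        [AddCommGroup Y] [Module k Y] [Module Bᵐᵒᵖ Y] [IsScalarTower k Bᵐᵒᵖ Y]
        (𝒳 : ℤ → Submodule k X) (𝒴 : ℤ → Submodule k Y) (𝒮 ℛ : ℕ → Set ℤ),
        GradedDet.IsDetermined 𝒜 𝒳 𝒮 → GradedDet.IsDetermined ℬ 𝒴 ℛ →
          letI := GradedDet.tensorRightModule k A B X Y
          haveI := GradedDet.tensorRightModule_isScalarTower k A B X Y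
          GradedDet.IsDetermined (GradedDet.tensorGrading 𝒜 ℬ) (GradedDet.tensorGrading 𝒳 𝒴)
            (GradedDet.tensorDegrees 𝒮 ℛ)) ∧
      (∀ s : ℕ, 2 ≤ s → GradedDet.IsTwoSDetermined s 𝒜 → GradedDet.IsTwoSDetermined s ℬ →
        GradedDet.IsTwoSDetermined s (GradedDet.tensorGrading 𝒜 ℬ)) ∧
      (GradedDet.IsKoszul 𝒜 → GradedDet.IsKoszul ℬ →
        GradedDet.IsKoszul (GradedDet.tensorGrading 𝒜 ℬ)) := by
  refine ⟨?_, ?_, ?_⟩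
  · intro X Y _ _ _ _ _ _ _ _ 𝒳 𝒴 𝒮 ℛ h𝒳 h𝒴
    exact GradedDet.isDetermined_tensor h𝒳 h𝒴
  · rintro s hs ⟨-, h𝒜⟩ ⟨-, hℬ⟩
    refine ⟨GradedDet.isQuiverGraded_tensor hA hB,
      (GradedDet.isDetermined_degreeZero_tensor hA hB h𝒜 hℬ).mono ?_⟩
    rintro _ _ ⟨j, l, rfl, n, hn, m, hm, rfl⟩
    exact (add_le_add hn hm).trans (GradedDet.chi_add_le hs j l)
  · rintro ⟨-, h𝒜⟩ ⟨-, hℬ⟩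
    refine ⟨GradedDet.isQuiverGraded_tensor hA hB,
      (GradedDet.isDetermined_degreeZero_tensor hA hB h𝒜 hℬ).mono ?_⟩
    rintro _ _ ⟨j, l, rfl, n, rfl, m, rfl, rfl⟩
    exact (Nat.cast_add j l).symm
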